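/- Let $n\ge 0$ be an integer and let $S$ be a subsemigroup of the additive group $(M_n(\mathbb{C}),+)$, i.e. a set of complex $n\times n$ matrices closed under addition. Assume that $M\mapsto \exp(M)$ is a homomorphism from $(S,+)$ to $(GL_n(\mathbb{C}),\times)$, i.e. $\exp(A+B)=\exp(A)\exp(B)$ for all $A,B\in S$. Then the complex linear span $V=\operatorname{Span}_{\mathbb{C}}(S)$ has property L: there exist $n$ linear forms $f_1,\dots,f_n:V\to\mathbb{C}$ such that, for every $M\in V$, the eigenvalues of $M$ counted with algebraic multiplicity (the roots of its characteristic polynomial) form the multiset $[f_1(M),\dots,f_n(M)]$; equivalently $\det(X I_n-M)=\prod_{k=1}^n (X-f_k(M))$ for all $M\in V$. -/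

import Mathlib

/-- The eigenvalues of a complex square matrix, counted with algebraic multiplicity:
the multiset `[z₁, …, zₙ]` such that the characteristic polynomial is `∏ (X - zₖ)`. -/
noncomputable def eigenvalueMultiset {n : ℕ} (M : Matrix (Fin n) (Fin n) ℂ) : Multiset ℂ :=
  M.charpoly.roots

/-- A linear subspace `V` of `M_n(ℂ)` has property L when there are `n` linear forms on `V`
whose values at each `M ∈ V` are the eigenvalues of `M`, counted with algebraic multiplicity. -/
def HasPropertyL {n : ℕ} (V : Submodule ℂ (Matrix (Fin n) (Fin n) ℂ)) : Prop :=
  ∃ f : Fin n → (V →ₗ[ℂ] ℂ), ∀ M : V,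
    eigenvalueMultiset (M : Matrix (Fin n) (Fin n) ℂ) =
      (Finset.univ : Finset (Fin n)).val.map (fun k => f k M)

open Polynomial Filter Topology

/-! Choose `A ∈ S` with the most distinct eigenvalues. For `B ∈ S` the matrices `N • A + j • B` lie
in `S`, so `A + (j/N) • B` has no more distinct eigenvalues than `A`: for large `N` no eigenvalue of
`A` splits (`exists_unsplit_eigenvalues`). An unsplit eigenvalue of multiplicity `m` is a simple
root of the `(m-1)`-st derivative of the characteristic polynomial, so as a function of `t = j/N` it
is either exactly affine or affine plus a term `κ t^q` with `q ≥ 2`, `κ ≠ 0` to leading order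
(`eigenvalue_dichotomy`). The exponential hypothesis excludes the second case
(`not_nonlinear_of_exp_eq`). Hence `N • A + B` has eigenvalues `N a_i + β(a_i)` for infinitely many
`N`, and by polynomial identity `B + s • A` has eigenvalues `β(a_i) + s a_i` for every `s`.
Comparing first-order terms gives `tr((x - A)⁻¹ B) = ∑ β(a_i) / (x - a_i)`, and uniqueness of
partial fractions makes each `β(a_i)` linear in `B`. The resulting forms pass from `S` to its span
by polynomial identities, one scalar at a time. -/

/-- `a` lists the eigenvalues of `M` with algebraic multiplicity. -/
def IsEigenvalueTuple {n : ℕ} (M : Matrix (Fin n) (Fin n) ℂ) (a : Fin n → ℂ) : Prop :=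
  M.charpoly = ∏ i, (X - C (a i))

/-! ### Eigenvalue tuples and spectra -/

namespace IsEigenvalueTuple

variable {n : ℕ} {M : Matrix (Fin n) (Fin n) ℂ} {a b : Fin n → ℂ}

theorem iff_det : IsEigenvalueTuple M a ↔
    ∀ z, (Matrix.scalar (Fin n) z - M).det = ∏ i, (z - a i) := by
  constructor
  · intro h z
    rw [← Matrix.eval_charpoly, h, eval_prod]
    simp
  · intro h
    refine Polynomial.funext fun z => ?_
    rw [Matrix.eval_charpoly, h, eval_prod]
    simp

theorem roots_eq (h : IsEigenvalueTuple M a) :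
    M.charpoly.roots = (Finset.univ : Finset (Fin n)).val.map a := by
  rw [h, ← roots_multiset_prod_X_sub_C (Finset.univ.val.map a), Multiset.map_map]
  rfl

theorem of_roots_eq (h : M.charpoly.roots = (Finset.univ : Finset (Fin n)).val.map a) :
    IsEigenvalueTuple M a := by
  rw [IsEigenvalueTuple,
    (IsAlgClosed.splits M.charpoly).eq_prod_roots_of_monic M.charpoly_monic, h, Multiset.map_map]
  rfl

theorem exists_tuple (M : Matrix (Fin n) (Fin n) ℂ) : ∃ a, IsEigenvalueTuple M a := by
  have hcard : M.charpoly.roots.toList.length = n := by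
    rw [Multiset.length_toList, ← (IsAlgClosed.splits M.charpoly).natDegree_eq_card_roots,
      Matrix.charpoly_natDegree_eq_dim, Fintype.card_fin]
  refine ⟨fun i => M.charpoly.roots.toList.get (i.cast hcard.symm), of_roots_eq ?_⟩
  have h : List.ofFn (fun i : Fin n => M.charpoly.roots.toList.get (i.cast hcard.symm)) =
      M.charpoly.roots.toList := by
    conv_rhs => rw [← List.ofFn_get M.charpoly.roots.toList]
    exact (List.ofFn_congr hcard _).symm
  rw [Fin.univ_val_map, h, Multiset.coe_toList]

theorem mem_spectrum_iff (h : IsEigenvalueTuple M a) {z : ℂ} :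
    z ∈ spectrum ℂ M ↔ ∃ i, a i = z := by
  rw [Matrix.mem_spectrum_iff_isRoot_charpoly, ← mem_roots M.charpoly_monic.ne_zero, h.roots_eq]
  simp

theorem spectrum_eq (h : IsEigenvalueTuple M a) : spectrum ℂ M = Set.range a := by
  ext z
  exact h.mem_spectrum_iff

/-- Two listings of one multiset have the same image under `y`, so a fixed enumeration of the
eigenvalues of `A` can replace the one that a limit produces. -/
theorem comp_of_comp (ha : IsEigenvalueTuple M a) (hb : IsEigenvalueTuple M b)
    {N : Matrix (Fin n) (Fin n) ℂ} {y : ℂ → ℂ} (h : IsEigenvalueTuple N fun i => y (b i)) :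
    IsEigenvalueTuple N fun i => y (a i) := by
  refine of_roots_eq ?_
  have := ha.roots_eq.symm.trans hb.roots_eq
  rw [h.roots_eq]
  calc _ = ((Finset.univ : Finset (Fin n)).val.map b).map y := by rw [Multiset.map_map]; rfl
    _ = _ := by rw [← this, Multiset.map_map]; rfl

theorem smul (h : IsEigenvalueTuple M a) {c : ℂ} (hc : c ≠ 0) :
    IsEigenvalueTuple (c • M) fun i => c * a i := by
  rw [iff_det] at h ⊢
  intro z
  have : Matrix.scalar (Fin n) z - c • M = c • (Matrix.scalar (Fin n) (z / c) - M) := by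
    rw [smul_sub, Matrix.scalar_apply, Matrix.scalar_apply, ← Matrix.diagonal_smul]
    congr 2
    ext
    simp [mul_div_cancel₀ _ hc]
  rw [this, Matrix.det_smul, h, Fintype.card_fin]
  calc c ^ n * ∏ i, (z / c - a i) = ∏ i, (c * (z / c - a i)) := by
        rw [Finset.prod_mul_distrib]; simp
    _ = _ := by
        refine Finset.prod_congr rfl fun i _ => ?_
        rw [mul_sub, mul_div_cancel₀ _ hc]

theorem rootMultiplicity_eq (h : IsEigenvalueTuple M a) (z : ℂ) :
    M.charpoly.rootMultiplicity z = (Finset.univ.filter fun i => z = a i).card := by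
  rw [← count_roots, h.roots_eq, Multiset.count_map]
  rfl

theorem rootMultiplicity_le {N : Matrix (Fin n) (Fin n) ℂ} {y : ℂ → ℂ}
    (h : IsEigenvalueTuple M a) (hN : IsEigenvalueTuple N fun i => y (a i)) (z : ℂ) :
    M.charpoly.rootMultiplicity z ≤ N.charpoly.rootMultiplicity (y z) := by
  rw [h.rootMultiplicity_eq, hN.rootMultiplicity_eq]
  refine Finset.card_le_card fun i hi => ?_
  simp only [Finset.mem_filter, Finset.mem_univ, true_and] at hi ⊢
  rw [hi]

end IsEigenvalueTuple

theorem spectrum_finite {n : ℕ} (M : Matrix (Fin n) (Fin n) ℂ) : (spectrum ℂ M).Finite := by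
  obtain ⟨a, ha⟩ := IsEigenvalueTuple.exists_tuple M
  rw [ha.spectrum_eq]
  exact Set.finite_range a

theorem ncard_spectrum_le {n : ℕ} (M : Matrix (Fin n) (Fin n) ℂ) : (spectrum ℂ M).ncard ≤ n := by
  obtain ⟨a, ha⟩ := IsEigenvalueTuple.exists_tuple M
  rw [ha.spectrum_eq, ← Set.image_univ]
  refine (Set.ncard_image_le Set.finite_univ).trans ?_
  simp [Set.ncard_univ]

theorem ncard_spectrum_smul {n : ℕ} (M : Matrix (Fin n) (Fin n) ℂ) {c : ℂ} (hc : c ≠ 0) :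
    (spectrum ℂ (c • M)).ncard = (spectrum ℂ M).ncard := by
  obtain ⟨a, ha⟩ := IsEigenvalueTuple.exists_tuple M
  rw [ha.spectrum_eq, (ha.smul hc).spectrum_eq]
  have : Set.range (fun i => c * a i) = (fun z => c * z) '' Set.range a := by
    rw [← Set.range_comp]; rfl
  rw [this, Set.ncard_image_of_injective _ (mul_right_injective₀ hc)]

theorem exists_inf_eigenspace_ne_bot {V : Type*} [AddCommGroup V] [Module ℂ V]
    [FiniteDimensional ℂ V] (f : Module.End ℂ V) {W : Submodule ℂ V} (hW : W ≠ ⊥)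
    (hf : ∀ v ∈ W, f v ∈ W) : ∃ c, W ⊓ f.eigenspace c ≠ ⊥ := by
  have : Nontrivial W := Submodule.nontrivial_iff_ne_bot.mpr hW
  obtain ⟨c, hc⟩ := Module.End.exists_eigenvalue (f.restrict hf)
  obtain ⟨v, hv⟩ := hc.exists_hasEigenvector
  refine ⟨c, (Submodule.ne_bot_iff _).mpr ⟨v, ⟨v.2, ?_⟩, fun h => hv.2 (Subtype.ext h)⟩⟩
  exact Module.End.mem_eigenspace_iff.mpr <| congrArg Subtype.val hv.apply_eq_smul

/-- Commuting operators preserve each other's eigenspaces, so the `x`-eigenspace contains a common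
eigenvector of `A` and `B`. -/
theorem exists_eigenvalues_of_mem_spectrum_pow_mul_pow {n : ℕ} {A B : Matrix (Fin n) (Fin n) ℂ}
    (h : Commute A B) (k l : ℕ) {x : ℂ} (hx : x ∈ spectrum ℂ (A ^ k * B ^ l)) :
    ∃ c ∈ spectrum ℂ A, ∃ d ∈ spectrum ℂ B, x = c ^ k * d ^ l := by
  set f : Module.End ℂ (Fin n → ℂ) := Matrix.toLinAlgEquiv' A with hf
  set g : Module.End ℂ (Fin n → ℂ) := Matrix.toLinAlgEquiv' B with hg
  have hfg : Commute f g := h.map Matrix.toLinAlgEquiv'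
  have hx' : (f ^ k * g ^ l).HasEigenvalue x := by
    rw [Module.End.hasEigenvalue_iff_mem_spectrum, hf, hg, ← map_pow, ← map_pow, ← map_mul,
      AlgEquiv.spectrum_eq]
    exact hx
  have hcf : Commute f (f ^ k * g ^ l) :=
    ((Commute.refl f).pow_right k).mul_right (hfg.pow_right l)
  have hcg : Commute g (f ^ k * g ^ l) :=
    (hfg.symm.pow_right k).mul_right ((Commute.refl g).pow_right l)
  have key : ∀ {p q : Module.End ℂ (Fin n → ℂ)} (c : ℂ), Commute p q →
      ∀ v ∈ q.eigenspace c, p v ∈ q.eigenspace c := by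
    intro p q c hpq v hv
    rw [Module.End.mem_eigenspace_iff] at hv ⊢
    rw [← Module.End.mul_apply, ← hpq.eq, Module.End.mul_apply, hv, map_smul]
  obtain ⟨c, hc⟩ := exists_inf_eigenspace_ne_bot f hx' (key x hcf)
  obtain ⟨d, hd⟩ := exists_inf_eigenspace_ne_bot g hc
    fun v hv => ⟨key x hcg v hv.1, key c hfg.symm v hv.2⟩
  obtain ⟨v, ⟨⟨hvx, hvc⟩, hvd⟩, hv⟩ := (Submodule.ne_bot_iff _).mp hd
  have evf : f.HasEigenvector c v := ⟨hvc, hv⟩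
  have evg : g.HasEigenvector d v := ⟨hvd, hv⟩
  refine ⟨c, ?_, d, ?_, ?_⟩
  · rw [← AlgEquiv.spectrum_eq (Matrix.toLinAlgEquiv' (R := ℂ) (n := Fin n)) A]
    exact (Module.End.hasEigenvalue_of_hasEigenvector evf).mem_spectrum
  · rw [← AlgEquiv.spectrum_eq (Matrix.toLinAlgEquiv' (R := ℂ) (n := Fin n)) B]
    exact (Module.End.hasEigenvalue_of_hasEigenvector evg).mem_spectrum
  · have e1 := Module.End.mem_eigenspace_iff.mp hvx
    rw [Module.End.mul_apply, evg.pow_apply l, map_smul, evf.pow_apply k, smul_smul] at e1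
    rw [mul_comm]
    exact (smul_left_injective ℂ hv e1).symm

/-! ### Spectral mapping for the exponential, and local bounds on eigenvalues -/

section exp

attribute [local instance] Matrix.linftyOpNormedRing Matrix.linftyOpNormedAlgebra

theorem exp_mem_spectrum_exp {n : ℕ} {M : Matrix (Fin n) (Fin n) ℂ} {x : ℂ}
    (hx : x ∈ spectrum ℂ M) : Complex.exp x ∈ spectrum ℂ (NormedSpace.exp M) := by
  rw [Complex.exp_eq_exp_ℂ]
  exact spectrum.exp_mem_exp M hx

theorem isCompact_pi_spectrum_bound {n : ℕ} (A : Matrix (Fin n) (Fin n) ℂ) :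
    ∃ K : Set (Fin n → ℂ), IsCompact K ∧
      ∀ᶠ M in 𝓝 A, ∀ a, IsEigenvalueTuple M a → a ∈ K := by
  refine ⟨Metric.closedBall 0 ((‖A‖ + 1) * ‖(1 : Matrix (Fin n) (Fin n) ℂ)‖),
    isCompact_closedBall _ _, ?_⟩
  have h : ∀ᶠ M : Matrix (Fin n) (Fin n) ℂ in 𝓝 A, ‖M‖ < ‖A‖ + 1 :=
    (continuous_norm.tendsto A).eventually (gt_mem_nhds (lt_add_one _))
  filter_upwards [h] with M hM a ha
  rw [mem_closedBall_zero_iff, pi_norm_le_iff_of_nonneg (by positivity)]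
  intro i
  have := spectrum.subset_closedBall_norm_mul M (ha.mem_spectrum_iff.mpr ⟨i, rfl⟩)
  rw [mem_closedBall_zero_iff] at this
  exact this.trans (by gcongr)

end exp

/-! ### Perturbation of eigenvalues along an ultrafilter -/

theorem exists_tendsto_eigenvalueTuple {n : ℕ} {ι : Type*} (U : Ultrafilter ι)
    {A : Matrix (Fin n) (Fin n) ℂ} {M : ι → Matrix (Fin n) (Fin n) ℂ} {x : ι → Fin n → ℂ}
    (hM : Tendsto M U (𝓝 A)) (hx : ∀ t, IsEigenvalueTuple (M t) (x t)) :
    ∃ a, IsEigenvalueTuple A a ∧ Tendsto x U (𝓝 a) := by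
  obtain ⟨K, hK, hev⟩ := isCompact_pi_spectrum_bound A
  have hxK : ∀ᶠ t in U, x t ∈ K := (hM.eventually hev).mono fun t ht => ht _ (hx t)
  obtain ⟨a, -, ha⟩ := hK.ultrafilter_le_nhds (U.map x) (le_principal_iff.mpr hxK)
  refine ⟨a, IsEigenvalueTuple.iff_det.mpr fun z => ?_, ha⟩
  have h1 : Tendsto (fun t => (Matrix.scalar (Fin n) z - M t).det) U
      (𝓝 (Matrix.scalar (Fin n) z - A).det) := by
    have hc : Continuous fun N : Matrix (Fin n) (Fin n) ℂ =>
        (Matrix.scalar (Fin n) z - N).det := (continuous_const.sub continuous_id).matrix_det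
    exact (hc.tendsto A).comp hM
  have h2 : Tendsto (fun t => ∏ i, (z - x t i)) U (𝓝 (∏ i, (z - a i))) := by
    have hc : Continuous fun y : Fin n → ℂ => ∏ i, (z - y i) := by fun_prop
    exact (hc.tendsto a).comp ha
  refine tendsto_nhds_unique h1 (h2.congr fun t => ?_)
  exact (IsEigenvalueTuple.iff_det.mp (hx t) z).symm

/-- If the number of distinct eigenvalues does not increase under a perturbation of `A`, then
the eigenvalues of the perturbed matrix are functions of those of `A`. -/
theorem exists_unsplit_eigenvalues {n : ℕ} {ι : Type*} (U : Ultrafilter ι)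
    {A : Matrix (Fin n) (Fin n) ℂ} {M : ι → Matrix (Fin n) (Fin n) ℂ} {a : Fin n → ℂ}
    (ha : IsEigenvalueTuple A a) (hM : Tendsto M U (𝓝 A))
    (hr : ∀ᶠ t in U, (spectrum ℂ (M t)).ncard ≤ (spectrum ℂ A).ncard) :
    ∃ y : ℂ → ι → ℂ, (∀ i, Tendsto (y (a i)) U (𝓝 (a i))) ∧
      ∀ᶠ t in U, IsEigenvalueTuple (M t) fun i => y (a i) t := by
  classical
  choose x hx using fun t => IsEigenvalueTuple.exists_tuple (M t)
  obtain ⟨b, hb, hlim⟩ := exists_tendsto_eigenvalueTuple U hM hx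
  have hne : ∀ᶠ t in U, ∀ i k, b i ≠ b k → x t i ≠ x t k := by
    rw [eventually_all]
    intro i
    rw [eventually_all]
    intro k
    by_cases hik : b i = b k
    · exact Eventually.of_forall fun t h => absurd hik h
    · have hi := (continuous_apply i).tendsto b |>.comp hlim
      have hk := (continuous_apply k).tendsto b |>.comp hlim
      exact ((hi.sub hk).eventually_ne (sub_ne_zero.mpr hik)).mono fun t ht _ => sub_ne_zero.mp ht
  have heq : ∀ᶠ t in U, ∀ i k, b i = b k → x t i = x t k := by
    filter_upwards [hne, hr] with t hne hr i k hik
    rw [(hx t).spectrum_eq, hb.spectrum_eq] at hr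
    have hwd : ∀ i k, x t i = x t k → b i = b k := fun i k h => by
      by_contra hc
      exact hne i k hc h
    -- Sends each eigenvalue of `M t` to its limit. It maps onto the spectrum of `A`, which has at
    -- least as many points, so it is injective: equal limits come from equal eigenvalues.
    let φ : ℂ → ℂ := fun z => if h : ∃ j, x t j = z then b h.choose else 0
    have hφ : ∀ j, φ (x t j) = b j := fun j => by
      have h : ∃ j', x t j' = x t j := ⟨j, rfl⟩
      simp only [φ, dif_pos h]
      exact hwd _ _ h.choose_spec
    have himg : φ '' Set.range (x t) = Set.range b := by
      rw [← Set.range_comp]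
      exact congrArg Set.range (funext hφ)
    have hcard : (φ '' Set.range (x t)).ncard = (Set.range (x t)).ncard := by
      refine le_antisymm (Set.ncard_image_le (Set.finite_range _)) ?_
      rwa [himg]
    have hinj := Set.injOn_of_ncard_image_eq hcard (Set.finite_range _)
    exact hinj ⟨i, rfl⟩ ⟨k, rfl⟩ (by rw [hφ, hφ, hik])
  let y : ℂ → ι → ℂ := fun z t => if h : ∃ j, b j = z then x t h.choose else 0
  have hy : ∀ᶠ t in U, ∀ i, y (b i) t = x t i := by
    filter_upwards [heq] with t ht i
    have h : ∃ j, b j = b i := ⟨i, rfl⟩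
    simp only [y, dif_pos h]
    exact ht _ _ h.choose_spec
  have hyb : ∀ i, Tendsto (y (b i)) U (𝓝 (b i)) := fun i => by
    refine ((continuous_apply i).tendsto b |>.comp hlim).congr' ?_
    filter_upwards [hy] with t ht
    exact (ht i).symm
  refine ⟨y, fun i => ?_, ?_⟩
  · obtain ⟨k, hk⟩ := hb.mem_spectrum_iff.mp (ha.mem_spectrum_iff.mpr ⟨i, rfl⟩)
    rw [← hk]
    exact hyb k
  · filter_upwards [hy] with t ht
    refine IsEigenvalueTuple.comp_of_comp (y := fun z => y z t) ha hb ?_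
    have : (fun i => y (b i) t) = x t := funext ht
    rw [this]
    exact hx t

/-! ### Local behaviour of a simple root of a bivariate polynomial -/

theorem continuous_evalEval (G : ℂ[X][X]) : Continuous fun p : ℂ × ℂ => G.evalEval p.1 p.2 := by
  induction G using Polynomial.induction_on' with
  | add p q hp hq => simp only [evalEval_add]; exact hp.add hq
  | monomial k c =>
    have : ∀ p : ℂ × ℂ, (monomial k c).evalEval p.1 p.2 = c.eval p.1 * p.2 ^ k := fun p => by
      rw [← C_mul_X_pow_eq_monomial, evalEval_mul, evalEval_pow, evalEval_C, evalEval_X]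
    simp only [this]
    exact (c.continuous.comp continuous_fst).mul (continuous_snd.pow k)

theorem eval_eval_eq_evalEval (G : ℂ[X][X]) (p : ℂ[X]) (t : ℂ) :
    (G.eval p).eval t = G.evalEval t (p.eval t) := by
  induction G using Polynomial.induction_on' with
  | add p q hp hq => simp only [evalEval_add, eval_add, hp, hq]
  | monomial k c =>
    rw [← C_mul_X_pow_eq_monomial, evalEval_mul, evalEval_pow, evalEval_C, evalEval_X]
    simp

theorem exists_factor (G : ℂ[X][X]) (p : ℂ[X]) :
    ∃ Q : ℂ[X][X], G = (X - C p) * Q + C (G.eval p) ∧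
      ∀ t, Q.evalEval t (p.eval t) = (derivative G).evalEval t (p.eval t) := by
  have h : G = (X - C p) * (G /ₘ (X - C p)) + C (G.eval p) := by
    rw [← modByMonic_X_sub_C_eq_C_eval, add_comm, modByMonic_add_div]
  refine ⟨_, h, fun t => ?_⟩
  conv_rhs => rw [h]
  simp [evalEval_C]

/-- Along a line `x = α + c t`, division gives `G = (x - (α + c t)) Q + g(t)` with `Q → d ≠ 0`, so a
root satisfies `x - (α + c t) = -g(t) / Q`. Either `g = 0`, or the order of `g` at `0` is the
exponent `q`. -/
theorem simple_root_dichotomy (G : ℂ[X][X]) (α : ℂ) (h0 : G.evalEval 0 α = 0)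
    (h1 : (derivative G).evalEval 0 α ≠ 0) :
    ∃ c : ℂ,
      (∀ {ι : Type} (l : Filter ι) (t x : ι → ℂ), Tendsto t l (𝓝 0) → Tendsto x l (𝓝 α) →
        (∀ᶠ i in l, G.evalEval (t i) (x i) = 0) → ∀ᶠ i in l, x i = α + c * t i) ∨
      ∃ q : ℕ, 2 ≤ q ∧ ∃ κ : ℂ, κ ≠ 0 ∧
        ∀ {ι : Type} (l : Filter ι) (t x : ι → ℂ), Tendsto t l (𝓝 0) → Tendsto x l (𝓝 α) →
        (∀ᶠ i in l, t i ≠ 0) → (∀ᶠ i in l, G.evalEval (t i) (x i) = 0) →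
        Tendsto (fun i => (x i - (α + c * t i)) / t i ^ q) l (𝓝 κ) := by
  set d := (derivative G).evalEval 0 α with hd
  obtain ⟨Q₀, hG₀, hQ₀⟩ := exists_factor G (C α)
  set g₀ := G.eval (C α) with hg₀
  -- The slope from implicit differentiation; it kills the linear coefficient of `g`, whence `q ≥
  -- 2`.
  set c := -(derivative g₀).eval 0 / d with hc
  set p : ℂ[X] := C α + C c * X with hp
  obtain ⟨Q, hG, hQ⟩ := exists_factor G p
  set g := G.eval p with hg
  have hp0 : ∀ t, p.eval t = α + c * t := fun t => by simp [hp]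
  have hQd : Q.evalEval 0 α = d := by
    have := hQ 0
    rwa [hp0, mul_zero, add_zero] at this
  have hQ₀d : Q₀.evalEval 0 α = d := by
    have := hQ₀ 0
    rwa [eval_C] at this
  have hg0 : g.eval 0 = 0 := by rw [hg, eval_eval_eq_evalEval, hp0, mul_zero, add_zero, h0]
  have hg1 : (derivative g).eval 0 = 0 := by
    have e : g = C c * X * Q₀.eval p + g₀ := by
      have := congrArg (eval p) hG₀
      rw [eval_add, eval_mul, eval_sub, eval_X, eval_C, eval_C] at this
      rw [hg, this, hp, add_sub_cancel_left]
    rw [e]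
    simp only [derivative_add, derivative_mul, derivative_C, derivative_X, eval_add, eval_mul,
      eval_C, eval_X, zero_mul, mul_zero, zero_add, add_zero, mul_one]
    rw [eval_eval_eq_evalEval, hp0, mul_zero, add_zero, hQ₀d, hc]
    field_simp
    ring
  have key : ∀ t x, G.evalEval t x = (x - (α + c * t)) * Q.evalEval t x + g.eval t := by
    intro t x
    conv_lhs => rw [hG]
    rw [evalEval_add, evalEval_mul, evalEval_sub, evalEval_X, evalEval_C, evalEval_C, hp0]
  have hlim : ∀ {ι : Type} (l : Filter ι) (t x : ι → ℂ), Tendsto t l (𝓝 0) →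
      Tendsto x l (𝓝 α) → Tendsto (fun i => Q.evalEval (t i) (x i)) l (𝓝 d) := by
    intro ι l t x ht hx
    rw [← hQd]
    exact ((continuous_evalEval Q).tendsto (0, α)).comp (ht.prodMk_nhds hx)
  refine ⟨c, ?_⟩
  by_cases hgz : g = 0
  · left
    intro ι l t x ht hx hr
    filter_upwards [(hlim l t x ht hx).eventually_ne h1, hr] with i hi hri
    rw [key, hgz, eval_zero, add_zero] at hri
    exact sub_eq_zero.mp ((mul_eq_zero.mp hri).resolve_right hi)
  · right
    obtain ⟨e, he, hnd⟩ := exists_eq_pow_rootMultiplicity_mul_and_not_dvd g hgz 0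
    set q := g.rootMultiplicity 0
    have hq : 2 ≤ q := by
      have := (one_lt_rootMultiplicity_iff_isRoot hgz (t := (0 : ℂ))).mpr ⟨hg0, hg1⟩
      omega
    have he0 : e.eval 0 ≠ 0 := fun h => hnd (dvd_iff_isRoot.mpr h)
    refine ⟨q, hq, -(e.eval 0) / d, div_ne_zero (neg_ne_zero.mpr he0) h1, ?_⟩
    intro ι l t x ht hx ht0 hr
    have hQl := hlim l t x ht hx
    have hel : Tendsto (fun i => e.eval (t i)) l (𝓝 (e.eval 0)) :=
      (e.continuous.tendsto 0).comp ht
    refine (hel.neg.div hQl h1).congr' ?_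
    filter_upwards [hQl.eventually_ne h1, hr, ht0] with i hi hri hti
    rw [key, he, eval_mul, eval_pow, eval_sub, eval_X, eval_C, sub_zero] at hri
    rw [Pi.div_apply, div_eq_div_iff hi (pow_ne_zero _ hti)]
    linear_combination -hri

/-- The pencil `A + tB` as a matrix of polynomials in `t`. -/
noncomputable def pencil {n : ℕ} (A B : Matrix (Fin n) (Fin n) ℂ) : Matrix (Fin n) (Fin n) ℂ[X] :=
  A.map C + (X : ℂ[X]) • B.map C

theorem map_eval_pencil {n : ℕ} (A B : Matrix (Fin n) (Fin n) ℂ) (t : ℂ) :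
    (pencil A B).map (evalRingHom t) = A + t • B := by
  ext i j
  simp [pencil]
  ring

theorem evalEval_iterate_derivative_charpoly_pencil {n : ℕ} (A B : Matrix (Fin n) (Fin n) ℂ)
    (k : ℕ) (t x : ℂ) :
    (derivative^[k] (pencil A B).charpoly).evalEval t x =
      (derivative^[k] (A + t • B).charpoly).eval x := by
  rw [← map_eval_pencil, Matrix.charpoly_map, iterate_derivative_map, ← eval₂_evalRingHom,
    eval₂_eq_eval_map]

/-- With `m` the multiplicity of `α`, the `(m-1)`-st derivative of the characteristic polynomial of
the pencil has `α` as a simple root at `t = 0`, and it vanishes at every nearby eigenvalue that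
keeps multiplicity `m`. -/
theorem eigenvalue_dichotomy {n : ℕ} (A B : Matrix (Fin n) (Fin n) ℂ) {α : ℂ}
    (hα : α ∈ spectrum ℂ A) :
    ∃ c : ℂ,
      (∀ {ι : Type} (l : Filter ι) (t x : ι → ℂ), Tendsto t l (𝓝 0) → Tendsto x l (𝓝 α) →
        (∀ᶠ i in l, A.charpoly.rootMultiplicity α ≤
          (A + t i • B).charpoly.rootMultiplicity (x i)) → ∀ᶠ i in l, x i = α + c * t i) ∨
      ∃ q : ℕ, 2 ≤ q ∧ ∃ κ : ℂ, κ ≠ 0 ∧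
        ∀ {ι : Type} (l : Filter ι) (t x : ι → ℂ), Tendsto t l (𝓝 0) → Tendsto x l (𝓝 α) →
        (∀ᶠ i in l, t i ≠ 0) →
        (∀ᶠ i in l, A.charpoly.rootMultiplicity α ≤
          (A + t i • B).charpoly.rootMultiplicity (x i)) →
        Tendsto (fun i => (x i - (α + c * t i)) / t i ^ q) l (𝓝 κ) := by
  set m := A.charpoly.rootMultiplicity α with hm
  have hne := A.charpoly_monic.ne_zero
  have hm0 : 0 < m :=
    (rootMultiplicity_pos hne).mpr (Matrix.mem_spectrum_iff_isRoot_charpoly.mp hα)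
  have hroot : ∀ t x, m ≤ (A + t • B).charpoly.rootMultiplicity x →
      (derivative^[m - 1] (pencil A B).charpoly).evalEval t x = 0 := by
    intro t x h
    rw [evalEval_iterate_derivative_charpoly_pencil]
    exact isRoot_iterate_derivative_of_lt_rootMultiplicity (by omega)
  have h0 := hroot 0 α (by rw [zero_smul, add_zero])
  have h1 : (derivative (derivative^[m - 1] (pencil A B).charpoly)).evalEval 0 α ≠ 0 := by
    rw [← Function.iterate_succ_apply' derivative, Nat.succ_eq_add_one, Nat.sub_add_cancel hm0,
      evalEval_iterate_derivative_charpoly_pencil, zero_smul, add_zero]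
    intro h
    have : m < A.charpoly.rootMultiplicity α := by
      rw [lt_rootMultiplicity_iff_isRoot_iterate_derivative hne]
      intro k hk
      rcases hk.lt_or_eq with hk | rfl
      · exact isRoot_iterate_derivative_of_lt_rootMultiplicity hk
      · exact h
    omega
  obtain ⟨c, h | ⟨q, hq, κ, hκ, h⟩⟩ := simple_root_dichotomy _ α h0 h1
  · exact ⟨c, Or.inl fun l t x ht hx hr => h l t x ht hx (hr.mono fun i hi => hroot _ _ hi)⟩
  · exact ⟨c, Or.inr ⟨q, hq, κ, hκ, fun l t x ht hx ht0 hr =>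
      h l t x ht hx ht0 (hr.mono fun i hi => hroot _ _ hi)⟩⟩

theorem AddSubsemigroup.nsmul_mem_of_pos {M : Type*} [AddMonoid M] (S : AddSubsemigroup M) {x : M}
    (hx : x ∈ S) {k : ℕ} (hk : 0 < k) : k • x ∈ S := by
  induction k, hk using Nat.le_induction with
  | base => simpa using hx
  | succ k _ ih => rw [succ_nsmul]; exact S.add_mem ih hx

/-! ### Excluding nonlinear eigenvalue branches -/

/-- Sequences with a nonlinear leading term cannot have exponentials of the form `c ^ N * d ^ j`
with `c`, `d` in a finite set. -/
theorem not_nonlinear_of_exp_eq {P : Type*} [Finite P] {c d : P → ℂ} (hc : ∀ p, c p ≠ 0)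
    {U : Ultrafilter ℕ} (hU : (U : Filter ℕ) ≤ atTop) {x : ℕ → ℕ → ℂ}
    {α s κ : ℂ} {q : ℕ} (hq : 2 ≤ q) (hκ : κ ≠ 0)
    (hx : ∀ j : ℕ, 0 < j → Tendsto
      (fun N : ℕ => (x j N - (α + s * ((j : ℂ) / N))) / ((j : ℂ) / N) ^ q) U (𝓝 κ))
    (hexp : ∀ j : ℕ, 0 < j → ∀ᶠ N : ℕ in U,
      ∃ p, Complex.exp (N * x j N) = c p ^ N * d p ^ j) : False := by
  -- For each `j` the ultrafilter selects one `p` from the finite set; by pigeonhole two values of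
  -- `j` share it.
  have hsel : ∀ j : ℕ, ∃ p, ∀ᶠ N : ℕ in U,
      Complex.exp (N * x (j + 1) N) = c p ^ N * d p ^ (j + 1) := fun j =>
    Ultrafilter.eventually_exists_iff.mp (hexp (j + 1) j.succ_pos)
  choose f hf using hsel
  obtain ⟨i, k, hik, hfik⟩ := Finite.exists_ne_map_eq_of_infinite f
  have hNne : ∀ᶠ N : ℕ in U, (N : ℂ) ≠ 0 := by
    filter_upwards [hU (eventually_ne_atTop 0)] with N hN
    exact_mod_cast hN
  have hv : ∀ j : ℕ, Tendsto
      (fun N : ℕ => (N : ℂ) ^ (q - 1) * (N * x (j + 1) N - N * α - s * (j + 1 : ℕ))) U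
      (𝓝 (((j + 1 : ℕ) : ℂ) ^ q * κ)) := by
    intro j
    refine ((hx (j + 1) j.succ_pos).const_mul _).congr' ?_
    filter_upwards [hNne] with N hN
    have hj : ((j + 1 : ℕ) : ℂ) ≠ 0 := by exact_mod_cast j.succ_ne_zero
    obtain ⟨r, rfl⟩ : ∃ r, q = r + 1 := ⟨q - 1, by omega⟩
    rw [Nat.add_sub_cancel, div_pow]
    field_simp
    ring
  -- Subtracting the two branches cancels `N * α` and, after exponentiating, `c ^ N`. So `exp (w N)`
  -- is eventually constant, while `w N` tends to `0` without vanishing, of order `N ^ (1 - q)`.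
  set w : ℕ → ℂ := fun N =>
    N * x (k + 1) N - N * x (i + 1) N - s * (((k + 1 : ℕ) : ℂ) - (i + 1 : ℕ)) with hw
  have hvw : Tendsto (fun N : ℕ => (N : ℂ) ^ (q - 1) * w N) U
      (𝓝 (((k + 1 : ℕ) : ℂ) ^ q * κ - ((i + 1 : ℕ) : ℂ) ^ q * κ)) := by
    refine ((hv k).sub (hv i)).congr fun N => ?_
    simp only [hw]
    ring
  have hlim_ne : ((k + 1 : ℕ) : ℂ) ^ q * κ - ((i + 1 : ℕ) : ℂ) ^ q * κ ≠ 0 := by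
    rw [← sub_mul]
    refine mul_ne_zero (sub_ne_zero.mpr fun h => hik ?_) hκ
    have h' : (k + 1) ^ q = (i + 1) ^ q := by exact_mod_cast h
    have := Nat.pow_left_injective (n := q) (by omega) h'
    omega
  have hwne : ∀ᶠ N in U, w N ≠ 0 :=
    (hvw.eventually_ne hlim_ne).mono fun N h => right_ne_zero_of_mul h
  have hinv : Tendsto (fun N : ℕ => ((N : ℂ) ^ (q - 1))⁻¹) U (𝓝 0) := by
    have h := (tendsto_inv_atTop_nhds_zero_nat (𝕜 := ℂ)).mono_left hU
    have h2 := h.pow (q - 1)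
    rw [zero_pow (by omega)] at h2
    exact h2.congr fun N => inv_pow _ _
  have hw0 : Tendsto w U (𝓝 0) := by
    have h := hinv.mul hvw
    rw [zero_mul] at h
    refine h.congr' ?_
    filter_upwards [hNne] with N hN
    rw [inv_mul_cancel_left₀ (pow_ne_zero _ hN)]
  set K := d (f i) ^ (k + 1) / d (f i) ^ (i + 1) /
    Complex.exp (s * (((k + 1 : ℕ) : ℂ) - (i + 1 : ℕ))) with hK
  have hexpw : ∀ᶠ N in U, Complex.exp (w N) = K := by
    filter_upwards [hf i, hf k] with N h1 h2
    rw [← hfik] at h2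
    simp only [hw, Complex.exp_sub, h1, h2, hK]
    rw [mul_div_mul_left _ _ (pow_ne_zero _ (hc _))]
  have hK1 : K = 1 := by
    have h1 : Tendsto (fun N => Complex.exp (w N)) U (𝓝 1) := by
      rw [← Complex.exp_zero]
      exact (Complex.continuous_exp.tendsto 0).comp hw0
    exact tendsto_nhds_unique (tendsto_const_nhds.congr' (hexpw.mono fun N h => h.symm)) h1
  have hloc : ∀ᶠ z in 𝓝[≠] (0 : ℂ), Complex.exp z ≠ 1 := by
    have h := (Complex.hasDerivAt_exp 0).eventually_ne (c := 1) (Complex.exp_ne_zero 0)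
    exact h
  have hcontra := (tendsto_nhdsWithin_iff.mpr ⟨hw0, hwne⟩).eventually hloc
  obtain ⟨N, hN1, hN2⟩ := (hcontra.and hexpw).exists
  exact hN1 (hN2.trans hK1)

/-! ### Affine eigenvalues in the semigroup -/

section Semigroup

variable {n : ℕ} {S : AddSubsemigroup (Matrix (Fin n) (Fin n) ℂ)}
  (hexp : ∀ A ∈ S, ∀ B ∈ S, NormedSpace.exp (A + B) = NormedSpace.exp A * NormedSpace.exp B)
  {A B : Matrix (Fin n) (Fin n) ℂ} (hA : A ∈ S) (hB : B ∈ S)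

include hexp hA hB

theorem exp_eq_of_mem_spectrum_nsmul_add_nsmul {k l : ℕ} (hk : 0 < k) (hl : 0 < l) {x : ℂ}
    (hx : x ∈ spectrum ℂ (k • A + l • B)) :
    ∃ p : spectrum ℂ (NormedSpace.exp A) × spectrum ℂ (NormedSpace.exp B),
      Complex.exp x = (p.1 : ℂ) ^ k * (p.2 : ℂ) ^ l := by
  have hcomm : Commute (NormedSpace.exp A) (NormedSpace.exp B) := by
    -- The two exponentials commute because `A + B = B + A`, even if `A` and `B` do not.
    rw [Commute, SemiconjBy, ← hexp A hA B hB, ← hexp B hB A hA, add_comm]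
  have h := exp_mem_spectrum_exp hx
  rw [hexp _ (S.nsmul_mem_of_pos hA hk) _ (S.nsmul_mem_of_pos hB hl), Matrix.exp_nsmul,
    Matrix.exp_nsmul] at h
  obtain ⟨c, hc, d, hd, e⟩ := exists_eigenvalues_of_mem_spectrum_pow_mul_pow hcomm k l h
  exact ⟨(⟨c, hc⟩, ⟨d, hd⟩), e⟩

/-- If `A` has the maximal number of distinct eigenvalues in `S`, then for infinitely many `N` the
eigenvalues of `N • A + B` are affine in `N`. -/
theorem frequently_isEigenvalueTuple {a : Fin n → ℂ} (ha : IsEigenvalueTuple A a)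
    (hmax : ∀ M ∈ S, (spectrum ℂ M).ncard ≤ (spectrum ℂ A).ncard) :
    ∃ β : ℂ → ℂ, ∃ᶠ N : ℕ in atTop,
      IsEigenvalueTuple ((N : ℂ) • A + B) fun i => N * a i + β (a i) := by
  set U : Ultrafilter ℕ := hyperfilter ℕ with hUdef
  have hU : (U : Filter ℕ) ≤ atTop := Nat.hyperfilter_le_atTop
  have hNne : ∀ᶠ N : ℕ in U, N ≠ 0 := hU (eventually_ne_atTop 0)
  have hscale : ∀ j N : ℕ, N ≠ 0 →
      (N : ℂ) • (A + ((j : ℂ) / N) • B) = N • A + j • B := fun j N hN => by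
    have hN' : (N : ℂ) ≠ 0 := by exact_mod_cast hN
    rw [smul_add, smul_smul, mul_div_cancel₀ _ hN', Nat.cast_smul_eq_nsmul,
      Nat.cast_smul_eq_nsmul]
  have ht : ∀ j : ℕ, Tendsto (fun N : ℕ => (j : ℂ) / N) U (𝓝 0) := fun j =>
    (tendsto_const_div_atTop_nhds_zero_nat (j : ℂ)).mono_left hU
  have hM : ∀ j : ℕ, Tendsto (fun N : ℕ => A + ((j : ℂ) / N) • B) U (𝓝 A) := fun j => by
    have := ((ht j).smul_const B).const_add A
    rwa [zero_smul, add_zero] at this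
  have hr : ∀ j : ℕ, 0 < j → ∀ᶠ N : ℕ in U,
      (spectrum ℂ (A + ((j : ℂ) / N) • B)).ncard ≤ (spectrum ℂ A).ncard := by
    intro j hj
    filter_upwards [hNne] with N hN
    rw [← ncard_spectrum_smul _ (Nat.cast_ne_zero.mpr hN : (N : ℂ) ≠ 0), hscale j N hN]
    exact hmax _ (S.add_mem (S.nsmul_mem_of_pos hA (Nat.pos_of_ne_zero hN))
      (S.nsmul_mem_of_pos hB hj))
  have hy : ∀ j : ℕ, ∃ y : ℂ → ℕ → ℂ, 0 < j → (∀ i, Tendsto (y (a i)) U (𝓝 (a i))) ∧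
      ∀ᶠ N : ℕ in U, IsEigenvalueTuple (A + ((j : ℂ) / N) • B) fun i => y (a i) N := by
    intro j
    by_cases hj : 0 < j
    · obtain ⟨y, h⟩ := exists_unsplit_eigenvalues U ha (hM j) (hr j hj)
      exact ⟨y, fun _ => h⟩
    · exact ⟨0, fun h => absurd h hj⟩
  choose y hy using hy
  have hmult : ∀ j : ℕ, 0 < j → ∀ i, ∀ᶠ N : ℕ in U, A.charpoly.rootMultiplicity (a i) ≤
      (A + ((j : ℂ) / N) • B).charpoly.rootMultiplicity (y j (a i) N) := by
    intro j hj i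
    filter_upwards [(hy j hj).2] with N hN
    exact ha.rootMultiplicity_le (y := fun z => y j z N) hN (a i)
  have haff : ∀ z, ∃ c : ℂ, (∃ i, a i = z) → ∀ᶠ N : ℕ in U, y 1 z N = z + c * (1 / N) := by
    intro z
    by_cases hz : ∃ i, a i = z
    · obtain ⟨i, rfl⟩ := hz
      obtain ⟨c, h | ⟨q, hq, κ, hκ, h⟩⟩ :=
        eigenvalue_dichotomy A B (ha.mem_spectrum_iff.mpr ⟨i, rfl⟩)
      · refine ⟨c, fun _ => ?_⟩
        have := h U (fun N : ℕ => ((1 : ℕ) : ℂ) / N) (y 1 (a i)) (ht 1) ((hy 1 one_pos).1 i)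
          (hmult 1 one_pos i)
        simpa only [Nat.cast_one] using this
      · exfalso
        have : Finite (spectrum ℂ (NormedSpace.exp A)) := spectrum_finite _
        have : Finite (spectrum ℂ (NormedSpace.exp B)) := spectrum_finite _
        have hne : ∀ p : spectrum ℂ (NormedSpace.exp A), (p : ℂ) ≠ 0 := fun p hp =>
          spectrum.zero_notMem ℂ (Matrix.isUnit_exp A) (hp ▸ p.2)
        refine not_nonlinear_of_exp_eq
          (P := spectrum ℂ (NormedSpace.exp A) × spectrum ℂ (NormedSpace.exp B))
          (c := fun p => p.1) (d := fun p => p.2) (fun p => hne p.1) hU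
          (x := fun j => y j (a i)) (α := a i) (s := c) hq hκ (fun j hj => ?_) fun j hj => ?_
        · refine h U (fun N : ℕ => (j : ℂ) / N) (y j (a i)) (ht j) ((hy j hj).1 i) ?_
            (hmult j hj i)
          filter_upwards [hNne] with N hN
          exact div_ne_zero (Nat.cast_ne_zero.mpr hj.ne') (Nat.cast_ne_zero.mpr hN)
        · filter_upwards [hNne, (hy j hj).2] with N hN hyN
          have hs := (hyN.smul (Nat.cast_ne_zero.mpr hN : (N : ℂ) ≠ 0)).mem_spectrum_iff.mpr
            ⟨i, rfl⟩
          rw [hscale j N hN] at hs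
          exact exp_eq_of_mem_spectrum_nsmul_add_nsmul hexp hA hB (Nat.pos_of_ne_zero hN) hj hs
    · exact ⟨0, fun h => absurd h hz⟩
  choose β hβ using haff
  refine ⟨β, Frequently.filter_mono (Eventually.frequently (f := (U : Filter ℕ)) ?_) hU⟩
  have hall : ∀ᶠ N : ℕ in U, ∀ i, y 1 (a i) N = a i + β (a i) * (1 / N) :=
    eventually_all.mpr fun i => hβ (a i) ⟨i, rfl⟩
  filter_upwards [hall, (hy 1 one_pos).2, hNne] with N h1 h2 hN
  have hN' : (N : ℂ) ≠ 0 := Nat.cast_ne_zero.mpr hN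
  have h3 := h2.smul hN'
  rw [hscale 1 N hN, one_nsmul, ← Nat.cast_smul_eq_nsmul ℂ] at h3
  convert h3 using 2 with i
  rw [h1]
  field_simp

end Semigroup

/-! ### From infinitely many integers to all scalars -/

theorem eq_of_frequently_eval_natCast_eq {p q : ℂ[X]}
    (h : ∃ᶠ N : ℕ in atTop, p.eval (N : ℂ) = q.eval (N : ℂ)) : p = q := by
  refine eq_of_infinite_eval_eq p q ?_
  have := (Nat.frequently_atTop_iff_infinite.mp h).image
    (f := ((↑) : ℕ → ℂ)) Nat.cast_injective.injOn
  refine this.mono ?_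
  rintro _ ⟨N, hN, rfl⟩
  exact hN

theorem eval_det_pencil {n : ℕ} (A B : Matrix (Fin n) (Fin n) ℂ) (s : ℂ) :
    (pencil A B).det.eval s = (A + s • B).det := by
  rw [← map_eval_pencil, ← coe_evalRingHom, RingHom.map_det]
  rfl

theorem eval_prod_C_add_X_mul_C {n : ℕ} (u v : Fin n → ℂ) (s : ℂ) :
    (∏ i, (C (u i) + X * C (v i))).eval s = ∏ i, (u i + s * v i) := by
  simp only [eval_prod, eval_add, eval_mul, eval_C, eval_X]

theorem det_pencil_eq_of_frequently {n : ℕ} {A B : Matrix (Fin n) (Fin n) ℂ} {u v : Fin n → ℂ}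
    (h : ∃ᶠ N : ℕ in atTop, (A + (N : ℂ) • B).det = ∏ i, (u i + N * v i)) :
    (pencil A B).det = ∏ i, (C (u i) + X * C (v i)) := by
  refine eq_of_frequently_eval_natCast_eq (h.mono fun N hN => ?_)
  rw [eval_det_pencil, hN, eval_prod_C_add_X_mul_C]

theorem isEigenvalueTuple_add_smul_of_frequently {n : ℕ} {A B : Matrix (Fin n) (Fin n) ℂ}
    {a b : Fin n → ℂ}
    (h : ∃ᶠ N : ℕ in atTop, IsEigenvalueTuple (B + (N : ℂ) • A) fun i => b i + N * a i) (s : ℂ) :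
    IsEigenvalueTuple (B + s • A) fun i => b i + s * a i := by
  rw [IsEigenvalueTuple.iff_det]
  intro z
  have h1 : ∀ s : ℂ, Matrix.scalar (Fin n) z - (B + s • A) =
      (Matrix.scalar (Fin n) z - B) + s • (-A) := fun s => by rw [smul_neg]; abel
  have h2 : ∀ s : ℂ, ∏ i, (z - (b i + s * a i)) = ∏ i, ((z - b i) + s * -a i) := fun s =>
    Finset.prod_congr rfl fun i _ => by ring
  have := det_pencil_eq_of_frequently (A := Matrix.scalar (Fin n) z - B) (B := -A)
    (u := fun i => z - b i) (v := fun i => -a i) (h.mono fun N hN => by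
      rw [← h1, ← h2]
      exact IsEigenvalueTuple.iff_det.mp hN z)
  rw [h1, h2, ← eval_det_pencil, this, eval_prod_C_add_X_mul_C]

/-! ### Linearity through the resolvent trace -/

theorem trace_resolvent_mul {n : ℕ} {A B : Matrix (Fin n) (Fin n) ℂ} {a b : Fin n → ℂ}
    (h : ∀ s : ℂ, IsEigenvalueTuple (B + s • A) fun i => b i + s * a i)
    (ha : IsEigenvalueTuple A a) {x : ℂ} (hx : ∀ i, a i ≠ x) :
    ((Matrix.scalar (Fin n) x - A)⁻¹ * B).trace = ∑ i, b i / (x - a i) := by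
  set R := Matrix.scalar (Fin n) x - A with hR
  have hxa : ∀ i, x - a i ≠ 0 := fun i => sub_ne_zero.mpr (hx i).symm
  have hdet : R.det = ∏ i, (x - a i) := IsEigenvalueTuple.iff_det.mp ha x
  have hunit : IsUnit R.det := by
    rw [hdet, isUnit_iff_ne_zero]
    exact Finset.prod_ne_zero_iff.mpr fun i _ => hxa i
  have key : ∀ τ : ℂ, τ ≠ 0 →
      (1 + τ • -(R⁻¹ * B)).det = ∏ i, (1 + τ * -(b i / (x - a i))) := by
    intro τ hτ
    have h1 := IsEigenvalueTuple.iff_det.mp ((h τ⁻¹).smul hτ) x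
    have h2 : Matrix.scalar (Fin n) x - τ • (B + τ⁻¹ • A) = R * (1 + τ • -(R⁻¹ * B)) := by
      rw [mul_add, mul_one, mul_smul_comm, mul_neg, Matrix.mul_nonsing_inv_cancel_left _ _ hunit,
        smul_add, smul_smul, mul_inv_cancel₀ hτ, one_smul, hR, smul_neg]
      abel
    rw [h2, Matrix.det_mul, hdet] at h1
    have h3 : ∏ i, (x - a i) ≠ 0 := Finset.prod_ne_zero_iff.mpr fun i _ => hxa i
    refine mul_left_cancel₀ h3 (h1.trans ?_)
    rw [← Finset.prod_mul_distrib]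
    refine Finset.prod_congr rfl fun i _ => ?_
    have := hxa i
    field_simp
    ring
  have hfreq : ∀ {P : ℕ → Prop}, (∀ N : ℕ, N ≠ 0 → P N) → ∃ᶠ N : ℕ in atTop, P N := fun hP =>
    ((eventually_ne_atTop 0).mono hP).frequently
  have e1 : (pencil 1 (-(R⁻¹ * B))).det = _ :=
    det_pencil_eq_of_frequently (u := fun _ => 1) (v := fun i => -(b i / (x - a i)))
      (hfreq fun N hN => key N (Nat.cast_ne_zero.mpr hN))
  -- A diagonal matrix with the same determinant pencil: equating derivatives at `0` compares the
  -- two traces without differentiating the product.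
  have e2 : (pencil 1 (Matrix.diagonal fun i => -(b i / (x - a i)))).det = _ :=
    det_pencil_eq_of_frequently (u := fun _ => 1) (v := fun i => -(b i / (x - a i)))
      (hfreq fun N _ => by
        rw [← Matrix.diagonal_one, ← Matrix.diagonal_smul, Matrix.diagonal_add,
          Matrix.det_diagonal]
        rfl)
  have htr : ∀ M : Matrix (Fin n) (Fin n) ℂ,
      (derivative (pencil 1 M).det).eval 0 = M.trace := fun M => by
    rw [← Matrix.derivative_det_one_add_X_smul M, pencil,
      Matrix.map_one _ (map_zero C) (map_one C)]
  have := (htr _).symm.trans ((congrArg (fun p : ℂ[X] => (derivative p).eval 0)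
    (e1.trans e2.symm)).trans (htr _))
  rw [Matrix.trace_neg, Matrix.trace_diagonal, Finset.sum_neg_distrib] at this
  exact neg_injective this

/-- Multiply by `x - a k` and let `x → a k`: what survives is `v (a k)` times the multiplicity of `a
k`. Weights depending on the index rather than on `a i` would only have zero sum. -/
theorem eq_zero_of_sum_div_eq_zero {n : ℕ} {a : Fin n → ℂ} {v : ℂ → ℂ}
    (h : ∀ x, (∀ i, a i ≠ x) → ∑ i, v (a i) / (x - a i) = 0) (k : Fin n) : v (a k) = 0 := by
  classical
  have hterm : ∀ i, Tendsto (fun x => (x - a k) * (v (a i) / (x - a i))) (𝓝[≠] (a k))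
      (𝓝 (if a i = a k then v (a k) else 0)) := by
    intro i
    split_ifs with hi
    · refine tendsto_const_nhds.congr' ?_
      filter_upwards [self_mem_nhdsWithin] with x hx
      rw [hi, mul_div_cancel₀ _ (sub_ne_zero.mpr hx)]
    · have hc : ContinuousAt (fun x => (x - a k) * (v (a i) / (x - a i))) (a k) := by
        have : a k - a i ≠ 0 := sub_ne_zero.mpr (Ne.symm hi)
        fun_prop (disch := assumption)
      have := hc.tendsto
      rw [sub_self, zero_mul] at this
      exact this.mono_left nhdsWithin_le_nhds
  have hlim := tendsto_finsetSum Finset.univ fun i _ => hterm i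
  have hev : ∀ᶠ x in 𝓝[≠] (a k), ∀ i, a i ≠ x := by
    rw [eventually_all]
    intro i
    by_cases hi : a i = a k
    · filter_upwards [self_mem_nhdsWithin] with x hx
      rw [hi]
      exact Ne.symm hx
    · exact nhdsWithin_le_nhds ((eventually_ne_nhds (Ne.symm hi)).mono fun x hx => hx.symm)
  have hzero : Tendsto (fun x => ∑ i, (x - a k) * (v (a i) / (x - a i))) (𝓝[≠] (a k)) (𝓝 0) := by
    refine tendsto_const_nhds.congr' ?_
    filter_upwards [hev] with x hx
    rw [← Finset.mul_sum, h x hx, mul_zero]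
  have hsum := tendsto_nhds_unique hlim hzero
  rw [← Finset.sum_filter, Finset.sum_const, nsmul_eq_mul] at hsum
  refine (mul_eq_zero.mp hsum).resolve_left ?_
  refine Nat.cast_ne_zero.mpr ?_
  exact Finset.card_ne_zero.mpr ⟨k, by simp⟩

/-- The values `v (a i)` are linear functions of the matrix `B` as soon as they are the weights in
the partial fraction decomposition of the trace of the resolvent of `A` times `B`. -/
theorem exists_linear_of_trace_resolvent {n : ℕ} (A : Matrix (Fin n) (Fin n) ℂ) (a : Fin n → ℂ) :
    ∃ f : Fin n → Matrix (Fin n) (Fin n) ℂ →ₗ[ℂ] ℂ,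
      ∀ (B : Matrix (Fin n) (Fin n) ℂ) (v : ℂ → ℂ),
        (∀ x, (∀ i, a i ≠ x) →
          ((Matrix.scalar (Fin n) x - A)⁻¹ * B).trace = ∑ i, v (a i) / (x - a i)) →
        ∀ i, f i B = v (a i) := by
  let Φ : (Set.range a → ℂ) →ₗ[ℂ] ({x // ∀ i, a i ≠ x} → ℂ) :=
    { toFun := fun v x => ∑ i, v ⟨a i, i, rfl⟩ / ((x : ℂ) - a i)
      map_add' := fun v w => by
        ext x
        simp [add_div, Finset.sum_add_distrib]
      map_smul' := fun c v => by
        ext x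
        simp [mul_div_assoc, Finset.mul_sum] }
  let Ψ : Matrix (Fin n) (Fin n) ℂ →ₗ[ℂ] ({x // ∀ i, a i ≠ x} → ℂ) :=
    { toFun := fun B x => ((Matrix.scalar (Fin n) (x : ℂ) - A)⁻¹ * B).trace
      map_add' := fun B B' => by
        ext x
        simp [mul_add]
      map_smul' := fun c B => by
        ext x
        simp }
  have hΦ : LinearMap.ker Φ = ⊥ := by
    rw [LinearMap.ker_eq_bot']
    intro v hv
    classical
    let w : ℂ → ℂ := fun z => if h : z ∈ Set.range a then v ⟨z, h⟩ else 0
    have hw : ∀ i, w (a i) = v ⟨a i, i, rfl⟩ := fun i => dif_pos ⟨i, rfl⟩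
    have h0 := eq_zero_of_sum_div_eq_zero (a := a) (v := w) fun x hx => by
      simp only [hw]
      exact congrFun hv ⟨x, hx⟩
    ext ⟨_, i, rfl⟩
    rw [← hw, h0]
    rfl
  -- A linear left inverse recovers the weights from the function of `x`, hence linearly from `B`.
  obtain ⟨L, hL⟩ := Φ.exists_leftInverse_of_injective hΦ
  refine ⟨fun i => LinearMap.proj ⟨a i, i, rfl⟩ ∘ₗ L ∘ₗ Ψ, fun B v hv i => ?_⟩
  have : Ψ B = Φ fun z => v z := by
    ext x
    exact hv x x.2
  rw [LinearMap.comp_apply, LinearMap.comp_apply, this, ← LinearMap.comp_apply L, hL]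
  rfl

/-! ### Extension to the span and conclusion -/

/-- Linear forms giving the eigenvalues on an additive semigroup do so on its linear span. -/
theorem isEigenvalueTuple_of_mem_span {n : ℕ} {S : AddSubsemigroup (Matrix (Fin n) (Fin n) ℂ)}
    {f : Fin n → Matrix (Fin n) (Fin n) ℂ →ₗ[ℂ] ℂ}
    (h : ∀ B ∈ S, IsEigenvalueTuple B fun i => f i B) {A : Matrix (Fin n) (Fin n) ℂ} (hA : A ∈ S)
    {M : Matrix (Fin n) (Fin n) ℂ}
    (hM : M ∈ Submodule.span ℂ (S : Set (Matrix (Fin n) (Fin n) ℂ))) :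
    IsEigenvalueTuple M fun i => f i M := by
  -- The arbitrary translate `Y` lets summands of `M` be absorbed in turn; keeping a base point `B ∈
  -- S` means only positive integer multiples need to lie in `S`.
  have key : ∀ M ∈ Submodule.span ℂ (S : Set (Matrix (Fin n) (Fin n) ℂ)),
      ∀ Y, (∀ B ∈ S, IsEigenvalueTuple (B + Y) fun i => f i (B + Y)) →
      ∀ B ∈ S, IsEigenvalueTuple (B + Y + M) fun i => f i (B + Y + M) := by
    intro M hM
    induction hM using Submodule.closure_induction with
    | zero => intro Y hY B hB; simpa only [add_zero] using hY B hB
    | add M M' _ _ ih ih' =>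
      intro Y hY B hB
      have := ih' (Y + M) (fun B hB => by simpa only [add_assoc] using ih Y hY B hB) B hB
      simpa only [add_assoc] using this
    | smul_mem s N hN =>
      intro Y hY B hB
      have := isEigenvalueTuple_add_smul_of_frequently (A := N) (B := B + Y)
        (a := fun i => f i N) (b := fun i => f i (B + Y)) (Eventually.frequently ?_) s
      · simpa only [map_add, map_smul, smul_eq_mul] using this
      · filter_upwards [eventually_gt_atTop 0] with k hk
        have := hY (B + k • N) (S.add_mem hB (S.nsmul_mem_of_pos hN hk))
        rw [← Nat.cast_smul_eq_nsmul ℂ, add_right_comm] at this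
        simpa only [map_add, map_smul, smul_eq_mul] using this
  have := key (M - A) (Submodule.sub_mem _ hM (Submodule.subset_span hA)) 0
    (by simpa only [add_zero] using h) A hA
  rwa [add_zero, add_sub_cancel] at this

theorem mainTheorem7 (n : ℕ) (S : AddSubsemigroup (Matrix (Fin n) (Fin n) ℂ))
    (hexp : ∀ A ∈ S, ∀ B ∈ S,
      NormedSpace.exp (A + B) = NormedSpace.exp A * NormedSpace.exp B) :
    HasPropertyL (Submodule.span ℂ (S : Set (Matrix (Fin n) (Fin n) ℂ))) := by
  -- A subsemigroup may be empty; its span is then zero and zero forms suffice.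
  rcases (S : Set (Matrix (Fin n) (Fin n) ℂ)).eq_empty_or_nonempty with hS | hS
  · refine ⟨0, fun M => ?_⟩
    have hspan : Submodule.span ℂ (S : Set (Matrix (Fin n) (Fin n) ℂ)) = ⊥ := by
      rw [hS, Submodule.span_empty]
    have hM : (M : Matrix (Fin n) (Fin n) ℂ) = 0 :=
      (Submodule.mem_bot ℂ).mp (hspan.le M.2)
    have h0 : IsEigenvalueTuple (M : Matrix (Fin n) (Fin n) ℂ) fun _ => 0 := by
      rw [hM, IsEigenvalueTuple.iff_det]
      intro z
      simp
    exact h0.roots_eq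
  · obtain ⟨A, hA, hmax⟩ : ∃ A ∈ S, ∀ M ∈ S, (spectrum ℂ M).ncard ≤ (spectrum ℂ A).ncard := by
      have hbdd : BddAbove ((fun M : Matrix (Fin n) (Fin n) ℂ => (spectrum ℂ M).ncard) '' S) :=
        ⟨n, by rintro _ ⟨M, -, rfl⟩; exact ncard_spectrum_le M⟩
      obtain ⟨A, hA, hAmax⟩ := Nat.sSup_mem (hS.image _) hbdd
      refine ⟨A, hA, fun M hM => ?_⟩
      have := le_csSup hbdd ⟨M, hM, rfl⟩
      exact this.trans hAmax.ge
    obtain ⟨a, ha⟩ := IsEigenvalueTuple.exists_tuple A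
    obtain ⟨f, hf⟩ := exists_linear_of_trace_resolvent A a
    have hfS : ∀ B ∈ S, IsEigenvalueTuple B fun i => f i B := by
      intro B hB
      obtain ⟨β, hβ⟩ := frequently_isEigenvalueTuple hexp hA hB ha hmax
      have hpencil := isEigenvalueTuple_add_smul_of_frequently (A := A) (B := B) (a := a)
        (b := fun i => β (a i)) (hβ.mono fun N hN => by simpa only [add_comm] using hN)
      have hval := hf B β fun x hx => trace_resolvent_mul hpencil ha hx
      simpa only [zero_smul, add_zero, zero_mul, ← hval] using hpencil 0
    refine ⟨fun i => f i ∘ₗ Submodule.subtype _, fun M => ?_⟩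
    exact (isEigenvalueTuple_of_mem_span hfS hA M.2).roots_eq
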